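/- Time is divided into unit slots $[t,t+1)$, $t\in\mathbb N$. Let $\Gamma=\{\tau_1,\dots,\tau_N\}$ be sporadic tasks on one processor with distinct fixed priorities ($\tau_1$ highest); $\tau_i$ has worst-case execution time $e_i\in\mathbb N^+$, minimum inter-arrival time $p_i\in\mathbb N^+$ and relative deadline $d_i=p_i$. Jobs are released at integer times, successive jobs of $\tau_i$ at least $p_i$ apart, and a job of $\tau_i$ needs an arbitrary integer execution time $\le e_i$ that the scheduler does not know. A task is active at $t$ if its most recent job, released at or before $t$, is incomplete. $hp(\tau_h)$ is the set of tasks with higher priority than $\tau_h$; the idle task is regarded as a task of lowest priority. $\Gamma$ is schedulable under a scheduling policy if, for all admissible release and execution times and all schedules that the policy can produce, every job completes by its deadline. For a time $t$ let $r_{h,t}$ be the most recent release time of $\tau_h$ at or before $t$ (before the first release, $r_{h,t}+p_h$ is a given time before which $\tau_h$ is known not to be released, e.g. $0$); let $o_{h,t}=r_{h,t}+p_h-t$; let $\tilde e_{h,t}$ be $e_h$ minus the amount that the current job of $\tau_h$ has executed if $\tau_h$ is active at $t$, and $0$ otherwise; and let the effective deadline $\overline d_{h,t}$ be $r_{h,t}+d_h$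 if $\tau_h$ is active at $t$, and $r_{h,t}+p_h+d_h$ otherwise. For $w\in\mathbb N$, the worst-case level-$\tau_h$ busy interval $W_{h,t}(w)$ is the value at which the iteration $$W^0=w+\tilde e_{h,t}+\sum_{\tau_j\in hp(\tau_h)}\tilde e_{j,t},\qquad W^{k+1}=W^0+\sum_{\tau_j\in hpe(\tau_h)}\max\Big(0,\Big\lceil\frac{W^k-o_{j,t}}{p_j}\Big\rceil\Big)e_j$$ becomes stationary, and $\infty$ if it does not, where $hpe(\tau_h)=hp(\tau_h)$ if $\tau_h$ is active at $t$ and $hpe(\tau_h)=hp(\tau_h)\cup\{\tau_h\}$ otherwise. Exact TaskShuffler++ executes in each slot either the highest-priority active task (the idle task if no task is active) or any other active task $\tau_i$, or the idle task, that was admitted as a candidate at a decision time $t$: it is admitted with a window of size $w\ge 1$ if $t+W_{h,t}(w)\le\overline d_{h,t}$ for every task $\tau_h$ of higher priority, active or not, and it may then execute for up to $w$ consecutive slots from $t$, as long as its job is incomplete. (With $w=1$ a decision is made in every slot; with $w=\tilde e_{i,t}$ the job may run to completion.) Candidates may be picked in any, in particular in any random, manner. Theorem. If $\Gamma$ is schedulable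 under fixed-priority preemptive scheduling, then $\Gamma$ is schedulable under exact TaskShuffler++; that is, every schedule randomized by exact TaskShuffler++ meets all deadlines. -/

import Mathlib

open scoped Classical

/-- A set of `N` implicit-deadline sporadic tasks (`d i = p i`) on one processor, listed in
decreasing order of their fixed, distinct priorities: `h < i` means that `h` has the higher
priority. -/
structure TaskSet (N : ℕ) where
  /-- worst-case execution time -/
  e : Fin N → ℕ
  /-- minimum inter-arrival time -/
  p : Fin N → ℕ
  e_pos : ∀ i, 0 < e i
  p_pos : ∀ i, 0 < p i

namespace TaskSet

variable {N : ℕ}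

/-- The relative deadline. -/
def d (Γ : TaskSet N) (i : Fin N) : ℕ := Γ.p i

/-- A run-time behaviour of the environment: the release times of every task (finitely or
infinitely many), at least the minimum inter-arrival time apart, and the actual execution time
of the job of `i` released at `r`, which is arbitrary up to the worst case. -/
structure Scenario (Γ : TaskSet N) where
  release : Fin N → Set ℕ
  exec : Fin N → ℕ → ℕ
  /-- what is known at time `0` about the first release of a task: it is not earlier than this
  (it is `0` when nothing is known) -/
  first : Fin N → ℕ
  sporadic : ∀ i, ∀ r ∈ release i, ∀ r' ∈ release i, r < r' → r + Γ.p i ≤ r'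
  exec_le : ∀ i, ∀ r ∈ release i, exec i r ≤ Γ.e i
  first_le : ∀ i, ∀ r ∈ release i, first i ≤ r

/-- Time slot `t` is the interval `[t, t + 1)`. A schedule says which task executes in each slot;
`none` is the idle task. -/
abbrev Schedule (N : ℕ) : Type := ℕ → Option (Fin N)

namespace Scenario

variable {Γ : TaskSet N} (S : Γ.Scenario) (σ : Schedule N)

/-- Task `i` has been released at or before time `t`. -/
def Released (i : Fin N) (t : ℕ) : Prop := ∃ r ∈ S.release i, r ≤ t

/-- Release time of the most recent job of `i` at time `t` (meaningful if `S.Released i t`). -/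
noncomputable def current (i : Fin N) (t : ℕ) : ℕ :=
  Nat.findGreatest (fun r => r ∈ S.release i) t

/-- Number of slots before `t` in which `i` has executed since its most recent release. -/
noncomputable def executed (i : Fin N) (t : ℕ) : ℕ :=
  ((Finset.Ico (S.current i t) t).filter (fun s => σ s = some i)).card

/-- Task `i` is active (in the ready queue) at time `t`: its most recent job is not complete. -/
def Active (i : Fin N) (t : ℕ) : Prop :=
  S.Released i t ∧ S.executed σ i t < S.exec i (S.current i t)

/-- Only active tasks execute. -/
def Valid : Prop := ∀ t i, σ t = some i → S.Active σ i t

/-- The job of `i` released at `r` completes by its deadline. Until then no other job of `i` is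
released, so the slots of `i` in this window are executions of this job. -/
def MeetsDeadline (i : Fin N) (r : ℕ) : Prop :=
  S.exec i r ≤ ((Finset.Ico r (r + Γ.d i)).filter (fun s => σ s = some i)).card

/-- Every job completes by its deadline. -/
def AllDeadlinesMet : Prop := ∀ i, ∀ r ∈ S.release i, S.MeetsDeadline σ i r

/-- The tasks whose priority is higher than that of a choice; the idle task has the lowest. -/
def Higher : Option (Fin N) → Set (Fin N)
  | some i => {h | h < i}
  | none => Set.univ

/-- The choice `c` is no priority inversion at time `t`: no higher-priority task is active. -/
def NoInversion (t : ℕ) (c : Option (Fin N)) : Prop :=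
  ∀ h ∈ Higher c, ¬ S.Active σ h t

/-- `σ` is a fixed-priority preemptive schedule. -/
def IsFixedPriority : Prop := S.Valid σ ∧ ∀ t, S.NoInversion σ t (σ t)

/-- The last release time `r_{h,t}`. Before the first release it is chosen such that
`r_{h,t} + p_h` is the earliest possible next release. -/
noncomputable def lastRelease (h : Fin N) (t : ℕ) : ℤ :=
  if S.Released h t then (S.current h t : ℤ) else (S.first h : ℤ) - Γ.p h

/-- The residue execution `ẽ_{h,t}`, as computed by the scheduler from the worst-case execution
time. -/
noncomputable def residue (h : Fin N) (t : ℕ) : ℕ :=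
  if S.Active σ h t then Γ.e h - S.executed σ h t else 0

/-- The effective deadline: of the current job of an active task, of the earliest possible
upcoming job of an inactive one. -/
noncomputable def effectiveDeadline (h : Fin N) (t : ℕ) : ℤ :=
  if S.Active σ h t then S.lastRelease h t + Γ.d h
  else S.lastRelease h t + Γ.p h + Γ.d h

/-- The offset `o_{j,t}` of the earliest next release of `j` from time `t`. -/
noncomputable def offset (j : Fin N) (t : ℕ) : ℤ := S.lastRelease j t + Γ.p j - t

/-- The base busy interval: the window, the outstanding work of the tasks above `h`, and that of
`h` (which is `0` if `h` is inactive). -/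
noncomputable def busyBase (h : Fin N) (t w : ℕ) : ℕ :=
  w + S.residue σ h t + ∑ j ∈ Finset.Iio h, S.residue σ j t

/-- The tasks whose future jobs are counted: those above `h`, and `h` itself if inactive. -/
noncomputable def hpe (h : Fin N) (t : ℕ) : Finset (Fin N) :=
  if S.Active σ h t then Finset.Iio h else Finset.Iic h

/-- The iterates of the busy-interval equation. The ceiling `⌈·⌉₊` is bounded below by `0`. -/
noncomputable def busyIter (h : Fin N) (t w : ℕ) : ℕ → ℕ
  | 0 => S.busyBase σ h t w
  | k + 1 => S.busyBase σ h t w + ∑ j ∈ S.hpe σ h t,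
      ⌈((busyIter h t w k : ℚ) - (S.offset j t : ℚ)) / (Γ.p j : ℚ)⌉₊ * Γ.e j

/-- The length `W_{h,t}(w)` of the worst-case level-`h` busy interval: the value at which the
iteration converges, `⊤` if it does not. -/
noncomputable def busyInterval (h : Fin N) (t w : ℕ) : ℕ∞ :=
  if H : ∃ k, S.busyIter σ h t w (k + 1) = S.busyIter σ h t w k then
    (S.busyIter σ h t w (Nat.find H) : ℕ∞)
  else ⊤

/-- The schedulability test `t + W_{h,t}(w) ≤` effective deadline (failed if `W_{h,t}(w) = ⊤`). -/
def PassesTest (h : Fin N) (t w : ℕ) : Prop :=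
  ∃ q : ℕ, S.busyInterval σ h t w = (q : ℕ∞) ∧ (t : ℤ) + q ≤ S.effectiveDeadline σ h t

/-- All tasks of higher priority than the choice `c` pass the test at time `t` with window `w`. -/
def InversionAllowed (t w : ℕ) (c : Option (Fin N)) : Prop :=
  ∀ h ∈ Higher c, S.PassesTest σ h t w

/-- `σ` can arise under exact TaskShuffler++, whatever candidates are drawn. In each slot the
choice is the highest-priority active task (or the idle task, if none is active), or it was
admitted as a candidate at a decision time `s ≤ t` with a window `w` that contains slot `t`, and
the same job (or the idle task) has been executing since then. A decision in every slot is `s = t`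
and `w = 1`; letting a job complete in inversion mode is `w =` its residue at `s`. -/
def IsTaskShuffler : Prop :=
  S.Valid σ ∧ ∀ t, S.NoInversion σ t (σ t) ∨
    ∃ s w, s ≤ t ∧ t < s + w ∧ S.InversionAllowed σ s w (σ t) ∧
      (∀ u, s ≤ u → u ≤ t → σ u = σ t) ∧
      (∀ i, σ t = some i → S.current i s = S.current i t)

end Scenario

/-- Schedulable under fixed-priority preemptive scheduling. -/
def FixedPrioritySchedulable (Γ : TaskSet N) : Prop :=
  ∀ (S : Γ.Scenario) (σ : Schedule N), S.IsFixedPriority σ → S.AllDeadlinesMet σ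

/-- Schedulable when randomized by exact TaskShuffler++. -/
def TaskShufflerSchedulable (Γ : TaskSet N) : Prop :=
  ∀ (S : Γ.Scenario) (σ : Schedule N), S.IsTaskShuffler σ → S.AllDeadlinesMet σ

end TaskSet

/-!
Suppose that under a shuffled schedule `σ` the job of task `h` released at `r` misses its deadline
`D = r + p h`. Let `u` be the last slot before `D` in which neither `h` nor a task above `h`
executes. Then there is a time `b ≤ D` at which no work of the levels up to `h` released before
`b` is left, and from which on only such work is executed until `D`
(`exists_busy_start`):

* if there is no such `u`, take `b = 0`;
* if slot `u` is no priority inversion, take `b = u + 1`;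
* otherwise slot `u` lies in a window of size `w` admitted at some `s ≤ u`, and `h` passed the test
  at `s`. Take `b = s + W`, where `W` is the worst-case busy interval. As `W` is a fixed point, `W - w`
  is an upper bound on the work of the levels up to `h` to be done in `[s, s + W)`, and at least
  `W - w` slots of this interval execute such work, so all of it is done at `s + W`
  (`backlog_eq_zero_of_passesTest`).

As the job is unfinished at `D` we have `b ≤ r`. Now discard all releases before `b` and run the
fixed-priority schedule. It is work-conserving at every level and meets all deadlines, so up to `D`
it has given the tasks above `h` at least as much service as `σ` has (`sum_service_le`). But `σ`
has been busy with levels up to `h` throughout `[b, D)`, so it has given `h` at least as much service as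
the fixed-priority schedule has, that is, all that the jobs of `h` released in `[b, D)` demand.
Hence the job is finished in `σ` too.

Unfinished jobs that are superseded by the next release of their task only lower the work to be
done in `σ`, so no induction over earlier deadline misses is needed.
-/

namespace TaskSet

variable {N : ℕ}

/-- The number of slots in `[a, b)` in which task `i` executes. -/
def service (σ : Schedule N) (i : Fin N) (a b : ℕ) : ℕ :=
  ((Finset.Ico a b).filter (fun s => σ s = some i)).card

lemma service_self (σ : Schedule N) (i : Fin N) (a : ℕ) : service σ i a a = 0 := by
  simp [service]

lemma service_succ (σ : Schedule N) (i : Fin N) {a b : ℕ} (h : a ≤ b) :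
    service σ i a (b + 1) = service σ i a b + if σ b = some i then 1 else 0 := by
  unfold service
  rw [Finset.card_filter, Finset.card_filter, Finset.sum_Ico_succ_top h]

lemma service_mono (σ : Schedule N) (i : Fin N) (a : ℕ) {b c : ℕ} (h : b ≤ c) :
    service σ i a b ≤ service σ i a c :=
  Finset.card_le_card (Finset.filter_subset_filter _ (Finset.Ico_subset_Ico_right h))

/-- A slot serves at most one task. -/
lemma sum_slot_le_one (s : Finset (Fin N)) (c : Option (Fin N)) :
    (∑ i ∈ s, if c = some i then 1 else 0) ≤ 1 := by
  cases c with
  | none => simp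
  | some j =>
    simp only [Option.some.injEq, Finset.sum_ite_eq]
    split_ifs <;> simp

lemma sum_slot_eq_one {s : Finset (Fin N)} {c : Option (Fin N)} (h : ∃ i ∈ s, c = some i) :
    (∑ i ∈ s, if c = some i then 1 else 0) = 1 := by
  obtain ⟨j, hj, rfl⟩ := h
  simp [hj]

lemma sum_service_le_length (σ : Schedule N) (s : Finset (Fin N)) {a b : ℕ} (h : a ≤ b) :
    ∑ i ∈ s, service σ i a b ≤ b - a := by
  induction b, h using Nat.le_induction with
  | base => simp [service_self]
  | succ b hab ih =>
    simp only [service_succ σ _ hab, Finset.sum_add_distrib]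
    have := sum_slot_le_one s (σ b)
    omega

/-- If every slot of `[m, b)` serves a task of `s`, these tasks receive at least `b - m` slots of
service in any interval `[a, b)`. -/
lemma length_le_sum_service (σ : Schedule N) (s : Finset (Fin N)) {a m b : ℕ} (ham : a ≤ m)
    (hmb : m ≤ b) (h : ∀ t, m ≤ t → t < b → ∃ i ∈ s, σ t = some i) :
    b - m ≤ ∑ i ∈ s, service σ i a b := by
  induction b, hmb using Nat.le_induction with
  | base => simp
  | succ b hmb ih =>
    simp only [service_succ σ _ (ham.trans hmb), Finset.sum_add_distrib]
    have h1 := sum_slot_eq_one (h b hmb (Nat.lt_succ_self b))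
    have h2 := ih fun t h1 h2 => h t h1 (by omega)
    omega

namespace Scenario

variable {Γ : TaskSet N} (S : Γ.Scenario) (σ : Schedule N)

/-- The total execution time of the jobs of `i` released in `[a, b)`. -/
noncomputable def demand (i : Fin N) (a b : ℕ) : ℕ :=
  ∑ r ∈ Finset.Ico a b, if r ∈ S.release i then S.exec i r else 0

/-- The work that the most recent job of `i` released strictly before `t` has left at `t`. The
work of a job superseded by a new release is forgotten, as in `Scenario.Active`. -/
noncomputable def backlog (i : Fin N) : ℕ → ℕ
  | 0 => 0
  | t + 1 => (if t ∈ S.release i then S.exec i t else backlog i t) - if σ t = some i then 1 else 0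

/-- The work that the most recent job of `i` released at or before `t` has left at `t`. -/
noncomputable def pending (i : Fin N) (t : ℕ) : ℕ :=
  if t ∈ S.release i then S.exec i t else S.backlog σ i t

lemma backlog_succ (i : Fin N) (t : ℕ) :
    S.backlog σ i (t + 1) = S.pending σ i t - if σ t = some i then 1 else 0 := rfl

variable {S} in
lemma current_of_mem {i : Fin N} {t : ℕ} (h : t ∈ S.release i) : S.current i t = t :=
  Nat.findGreatest_eq h

variable {S} in
lemma current_succ_of_notMem {i : Fin N} {t : ℕ} (h : t + 1 ∉ S.release i) :
    S.current i (t + 1) = S.current i t := Nat.findGreatest_of_not h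

lemma current_le (i : Fin N) (t : ℕ) : S.current i t ≤ t := Nat.findGreatest_le t

variable {S} in
lemma Released.current_mem {i : Fin N} {t : ℕ} (h : S.Released i t) :
    S.current i t ∈ S.release i := by
  obtain ⟨r, hr, hrt⟩ := h
  exact Nat.findGreatest_spec (P := fun r => r ∈ S.release i) hrt hr

variable {S} in
lemma released_succ_of_notMem {i : Fin N} {t : ℕ} (h : t + 1 ∉ S.release i) :
    S.Released i (t + 1) ↔ S.Released i t := by
  constructor
  · rintro ⟨r, hr, hrt⟩
    refine ⟨r, hr, ?_⟩
    rcases Nat.lt_or_ge t r with h' | h'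
    · exact absurd (by rwa [show t + 1 = r by omega]) h
    · exact h'
  · rintro ⟨r, hr, hrt⟩
    exact ⟨r, hr, by omega⟩

lemma pending_eq (i : Fin N) (t : ℕ) :
    S.pending σ i t =
      if S.Released i t then S.exec i (S.current i t) - S.executed σ i t else 0 := by
  have key : ∀ t, t ∈ S.release i → S.pending σ i t =
      if S.Released i t then S.exec i (S.current i t) - S.executed σ i t else 0 := by
    intro t ht
    rw [if_pos ⟨t, ht, le_rfl⟩]
    simp [pending, ht, executed, current_of_mem ht]
  induction t with
  | zero =>
    by_cases h0 : 0 ∈ S.release i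
    · exact key 0 h0
    · have : ¬ S.Released i 0 := by
        rintro ⟨r, hr, hr0⟩
        exact h0 (by rwa [Nat.le_zero.1 hr0] at hr)
      simp [pending, h0, this, backlog]
  | succ t ih =>
    by_cases h0 : t + 1 ∈ S.release i
    · exact key _ h0
    · have hp : S.pending σ i (t + 1) = S.backlog σ i (t + 1) := by simp [pending, h0]
      have hex : S.executed σ i (t + 1) =
          S.executed σ i t + if σ t = some i then 1 else 0 := by
        unfold executed
        rw [current_succ_of_notMem h0]
        exact service_succ σ i (S.current_le i t)
      rw [hp, backlog_succ, ih, hex, current_succ_of_notMem h0]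
      simp only [released_succ_of_notMem h0]
      split_ifs <;> omega

lemma active_iff (i : Fin N) (t : ℕ) : S.Active σ i t ↔ 0 < S.pending σ i t := by
  rw [pending_eq, Active]
  split_ifs with h
  · simp [h]
  · simp [h]

/-- The scheduler's residue, computed from the worst-case execution time, bounds the actual
remaining work. -/
lemma pending_le_residue (i : Fin N) (t : ℕ) : S.pending σ i t ≤ S.residue σ i t := by
  unfold residue
  split_ifs with h
  · rw [pending_eq, if_pos h.1]
    have := S.exec_le i _ h.1.current_mem
    omega
  · rw [active_iff] at h
    omega

lemma backlog_succ_eq_zero_of_not_active {i : Fin N} {t : ℕ} (h : ¬ S.Active σ i t) :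
    S.backlog σ i (t + 1) = 0 := by
  rw [active_iff] at h
  rw [backlog_succ]
  omega

variable {S σ} in
lemma Valid.backlog_succ_add (hσ : S.Valid σ) (i : Fin N) (t : ℕ) :
    S.backlog σ i (t + 1) + (if σ t = some i then 1 else 0) = S.pending σ i t := by
  rw [backlog_succ]
  split_ifs with h
  · have := (S.active_iff σ i t).1 (hσ t i h)
    omega
  · omega

lemma demand_succ (i : Fin N) {a b : ℕ} (h : a ≤ b) :
    S.demand i a (b + 1) = S.demand i a b + if b ∈ S.release i then S.exec i b else 0 :=
  Finset.sum_Ico_succ_top h _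

lemma demand_eq_zero {i : Fin N} {a b : ℕ} (h : ∀ r ∈ S.release i, a ≤ r → b ≤ r) :
    S.demand i a b = 0 := by
  refine Finset.sum_eq_zero fun r hr => ?_
  rw [Finset.mem_Ico] at hr
  rw [if_neg fun hmem => ?_]
  have := h r hmem hr.1
  omega

/-- If the releases of `i` from `a` on are not earlier than `x`, at most `n` of them fall
before `x + n * p i`, because they are at least `p i` apart. -/
lemma demand_le_mul (i : Fin N) (t n : ℕ) : ∀ (a : ℕ) (x : ℤ),
    (∀ r ∈ S.release i, a ≤ r → x ≤ r) → (t : ℤ) ≤ x + n * Γ.p i →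
    S.demand i a t ≤ n * Γ.e i := by
  induction n with
  | zero =>
    intro a x hx ht
    rw [demand_eq_zero]
    · simp
    · intro r hr har
      have := hx r hr har
      push_cast at ht
      omega
  | succ n ih =>
    intro a x hx ht
    by_cases H : ∃ r, r ∈ S.release i ∧ a ≤ r ∧ r < t
    · obtain ⟨hmem, har, hrt⟩ := Nat.find_spec H
      have hmin : ∀ r ∈ S.release i, a ≤ r → Nat.find H ≤ r := by
        intro r hr har
        by_contra hlt
        exact Nat.find_min H (not_le.1 hlt) ⟨hr, har, by omega⟩
      set ρ := Nat.find H
      have h1 : S.demand i (ρ + 1) t ≤ n * Γ.e i := by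
        refine ih (ρ + 1) (ρ + Γ.p i) ?_ ?_
        · intro r hr hρr
          exact_mod_cast S.sporadic i ρ hmem r hr hρr
        · have := hx ρ hmem har
          push_cast at ht
          linarith
      have h2 : S.demand i a ρ = 0 := S.demand_eq_zero hmin
      have h3 : S.demand i a t = S.demand i a (ρ + 1) + S.demand i (ρ + 1) t :=
        (Finset.sum_Ico_consecutive _ (by omega) (by omega)).symm
      rw [h3, S.demand_succ i har, if_pos hmem, h2]
      have := S.exec_le i ρ hmem
      rw [add_mul]
      omega
    · rw [demand_eq_zero]
      · simp
      · intro r hr har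
        by_contra hlt
        exact H ⟨r, hr, har, by omega⟩

variable {S σ} in
/-- Work accounting, starting just after the releases at `a`. -/
lemma Valid.service_add_backlog_le_pending (hσ : S.Valid σ) (i : Fin N) {a b : ℕ} (h : a < b) :
    service σ i a b + S.backlog σ i b ≤ S.pending σ i a + S.demand i (a + 1) b := by
  replace h : a + 1 ≤ b := h
  induction b, h using Nat.le_induction with
  | base =>
    rw [service_succ σ i le_rfl, service_self, ← hσ.backlog_succ_add i a]
    omega
  | succ b hab ih =>
    have h2 := hσ.backlog_succ_add i b
    rw [service_succ σ i (by omega), demand_succ _ _ hab]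
    unfold pending at h2
    split_ifs at h2 ⊢ <;> omega

variable {S σ} in
/-- Work accounting, starting just before the releases at `a`. -/
lemma Valid.service_add_backlog_le (hσ : S.Valid σ) (i : Fin N) {a b : ℕ} (h : a ≤ b) :
    service σ i a b + S.backlog σ i b ≤ S.backlog σ i a + S.demand i a b := by
  induction b, h using Nat.le_induction with
  | base => simp [service_self]
  | succ b hab ih =>
    have h2 := hσ.backlog_succ_add i b
    rw [service_succ σ i hab, demand_succ _ _ hab]
    unfold pending at h2
    split_ifs at h2 ⊢ <;> omega

/-- In the absence of work dropped at a release, the accounting is exact. -/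
lemma Valid.service_add_backlog_eq {S : Γ.Scenario} {σ : Schedule N} (hσ : S.Valid σ) (i : Fin N)
    (hr : ∀ r ∈ S.release i, S.backlog σ i r = 0) {a b : ℕ} (h : a ≤ b) :
    service σ i a b + S.backlog σ i b = S.backlog σ i a + S.demand i a b := by
  induction b, h using Nat.le_induction with
  | base => simp [service_self, demand]
  | succ b hab ih =>
    have h2 := hσ.backlog_succ_add i b
    rw [service_succ σ i hab, demand_succ _ _ hab]
    unfold pending at h2
    by_cases hb : b ∈ S.release i
    · have h3 := hr b hb
      rw [if_pos hb] at h2 ⊢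
      omega
    · rw [if_neg hb] at h2 ⊢
      omega

/-- Until the next release, the backlog is what the service has left of the last job. -/
lemma backlog_eq_exec_sub {i : Fin N} {r : ℕ} (hr : r ∈ S.release i) {t : ℕ} (hrt : r < t)
    (hno : ∀ r' ∈ S.release i, r < r' → t ≤ r') :
    S.backlog σ i t = S.exec i r - service σ i r t := by
  induction t, (hrt : r + 1 ≤ t) using Nat.le_induction with
  | base => simp [backlog_succ, pending, hr, service_succ σ i le_rfl, service_self]
  | succ t hrt' ih =>
    have h1 := ih fun r' hr' hlt => by have := hno r' hr' hlt; omega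
    have h2 : t ∉ S.release i := fun ht => by have := hno t ht hrt'; omega
    rw [backlog_succ, pending, if_neg h2, h1, service_succ σ i (by omega)]
    omega

lemma meetsDeadline_iff {i : Fin N} {r : ℕ} (hr : r ∈ S.release i) :
    S.MeetsDeadline σ i r ↔ S.backlog σ i (r + Γ.p i) = 0 := by
  rw [S.backlog_eq_exec_sub σ hr (by have := Γ.p_pos i; omega) (S.sporadic i r hr)]
  exact Nat.sub_eq_zero_iff_le.symm

/-- A job is finished at its deadline if it is finished at an earlier time. -/
lemma meetsDeadline_of_backlog_eq_zero {i : Fin N} {r : ℕ} (hr : r ∈ S.release i) {t : ℕ}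
    (hrt : r < t) (htD : t ≤ r + Γ.p i) (h0 : S.backlog σ i t = 0) : S.MeetsDeadline σ i r := by
  rw [S.backlog_eq_exec_sub σ hr hrt
    fun r' hr' hlt => htD.trans (S.sporadic i r hr r' hr' hlt)] at h0
  exact (Nat.sub_eq_zero_iff_le.1 h0).trans (service_mono σ i r htD)

/-- A job that misses its deadline is active from its release to its deadline. -/
lemma active_of_not_meetsDeadline {i : Fin N} {r : ℕ} (hr : r ∈ S.release i)
    (hmiss : ¬ S.MeetsDeadline σ i r) {t : ℕ} (hrt : r ≤ t) (htD : t < r + Γ.p i) :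
    S.Active σ i t := by
  by_contra hact
  exact hmiss (S.meetsDeadline_of_backlog_eq_zero σ hr (Nat.lt_succ_of_le hrt) htD
    (S.backlog_succ_eq_zero_of_not_active σ hact))

/-- If all deadlines are met, no job is superseded before it is finished. -/
lemma backlog_eq_zero_of_mem {S : Γ.Scenario} {σ : Schedule N} (hmet : S.AllDeadlinesMet σ)
    {i : Fin N} {t : ℕ} (ht : t ∈ S.release i) : S.backlog σ i t = 0 := by
  cases t with
  | zero => rfl
  | succ t =>
    by_contra hne
    have hact : S.Active σ i t := by
      by_contra hact
      exact hne (S.backlog_succ_eq_zero_of_not_active σ hact)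
    have hcur := hact.1.current_mem
    have hle := S.current_le i t
    have hD := S.sporadic i _ hcur _ ht (by omega)
    have hno : ∀ r' ∈ S.release i, S.current i t < r' → t + 1 ≤ r' := by
      intro r' hr' hlt
      by_contra hle'
      exact Nat.findGreatest_is_greatest hlt (by omega) hr'
    rw [S.backlog_eq_exec_sub σ hcur (by omega) hno] at hne
    have h1 : S.exec i (S.current i t) ≤ service σ i (S.current i t) (S.current i t + Γ.p i) :=
      hmet i _ hcur
    have h2 := service_mono σ i (S.current i t) hD
    omega

/-! ### The fixed-priority schedule -/

/-- The highest-priority task with outstanding work, where `f` is the outstanding work. -/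
noncomputable def highest (f : Fin N → ℕ) : Option (Fin N) :=
  if h : (Finset.univ.filter fun i => 0 < f i).Nonempty then some (Finset.min' _ h) else none

lemma pos_of_highest_eq {f : Fin N → ℕ} {i : Fin N} (h : highest f = some i) : 0 < f i := by
  unfold highest at h
  split_ifs at h with hne
  · have := Finset.min'_mem _ hne
    rw [Option.some.inj h] at this
    simpa using this

lemma eq_zero_of_mem_higher {f : Fin N → ℕ} {j : Fin N} (h : j ∈ Higher (highest f)) :
    f j = 0 := by
  by_contra hne
  have hj : j ∈ Finset.univ.filter fun i => 0 < f i := by simp; omega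
  unfold highest at h
  rw [dif_pos ⟨j, hj⟩] at h
  exact absurd (Finset.min'_le _ j hj) (not_le.2 h)

/-- The backlog under the fixed-priority schedule. It is defined before the schedule, which depends
on it. -/
noncomputable def fpBacklog : ℕ → Fin N → ℕ
  | 0 => fun _ => 0
  | t + 1 => fun i => (if t ∈ S.release i then S.exec i t else fpBacklog t i) -
      if highest (fun j => if t ∈ S.release j then S.exec j t else fpBacklog t j) = some i
        then 1 else 0

/-- The fixed-priority preemptive schedule of a scenario. -/
noncomputable def fpSchedule : Schedule N := fun t =>
  highest fun j => if t ∈ S.release j then S.exec j t else S.fpBacklog t j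

lemma backlog_fpSchedule (i : Fin N) (t : ℕ) :
    S.backlog S.fpSchedule i t = S.fpBacklog t i := by
  induction t with
  | zero => rfl
  | succ t ih => rw [backlog, ih]; rfl

lemma fpSchedule_eq (t : ℕ) :
    S.fpSchedule t = highest fun j => S.pending S.fpSchedule j t := by
  simp only [pending, backlog_fpSchedule]
  rfl

lemma isFixedPriority_fpSchedule : S.IsFixedPriority S.fpSchedule := by
  refine ⟨fun t i h => ?_, fun t j hj => ?_⟩
  · rw [fpSchedule_eq] at h
    exact (S.active_iff _ i t).2 (pos_of_highest_eq h)
  · rw [fpSchedule_eq] at hj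
    rw [active_iff, eq_zero_of_mem_higher hj]
    exact lt_irrefl 0

/-! ### Discarding the releases before a given time -/

/-- The scenario in which the jobs released before `b` are dropped. -/
def discard (b : ℕ) : Γ.Scenario where
  release i := {r | r ∈ S.release i ∧ b ≤ r}
  exec := S.exec
  first := S.first
  sporadic i r hr r' hr' := S.sporadic i r hr.1 r' hr'.1
  exec_le i r hr := S.exec_le i r hr.1
  first_le i r hr := S.first_le i r hr.1

lemma demand_discard (i : Fin N) (b t : ℕ) : (S.discard b).demand i b t = S.demand i b t := by
  refine Finset.sum_congr rfl fun r hr => ?_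
  have hbr : b ≤ r := (Finset.mem_Ico.1 hr).1
  simp [discard, hbr]

lemma backlog_discard (i : Fin N) (b : ℕ) : (S.discard b).backlog σ i b = 0 := by
  have : ∀ t ≤ b, (S.discard b).backlog σ i t = 0 := by
    intro t
    induction t with
    | zero => intro _; rfl
    | succ t ih =>
      intro ht
      have h1 : t ∉ (S.discard b).release i := fun h => by have := h.2; omega
      rw [backlog_succ, pending, if_neg h1, ih (by omega)]
      simp
  exact this b le_rfl

/-- Without backlog at `b`, no valid schedule serves the tasks above `h` more than the
fixed-priority schedule of the releases from `b` on, if that schedule meets all deadlines. -/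
lemma sum_service_le {σ τ : Schedule N} (hσ : S.Valid σ) {b : ℕ} (h : Fin N)
    (hb : ∀ i < h, S.backlog σ i b = 0) (hτ : (S.discard b).IsFixedPriority τ)
    (hmet : (S.discard b).AllDeadlinesMet τ) {t : ℕ} (hbt : b ≤ t) :
    ∑ i ∈ Finset.Iio h, service σ i b t ≤ ∑ i ∈ Finset.Iio h, service τ i b t := by
  induction t, hbt using Nat.le_induction with
  | base => simp [service_self]
  | succ t hbt ih =>
    by_cases hrun : ∃ i ∈ Finset.Iio h, τ t = some i
    · simp only [service_succ _ _ hbt, Finset.sum_add_distrib]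
      have h1 := sum_slot_eq_one hrun
      have h2 := sum_slot_le_one (Finset.Iio h) (σ t)
      omega
    · -- `τ` has then finished all released work above `h`.
      refine Finset.sum_le_sum fun i hi => ?_
      have hih : i < h := Finset.mem_Iio.1 hi
      have hhigh : i ∈ Higher (τ t) := by
        cases hc : τ t with
        | none => trivial
        | some j =>
          have hj : ¬ j < h := fun hj => hrun ⟨j, Finset.mem_Iio.2 hj, hc⟩
          exact lt_of_lt_of_le hih (not_lt.1 hj)
      have h0 := (S.discard b).backlog_succ_eq_zero_of_not_active τ (hτ.2 t i hhigh)
      have h1 := hτ.1.service_add_backlog_eq i (fun r hr => backlog_eq_zero_of_mem hmet hr)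
        (Nat.le_succ_of_le hbt)
      have h2 := hσ.service_add_backlog_le i (Nat.le_succ_of_le hbt)
      rw [hb i hih] at h2
      rw [backlog_discard, demand_discard, Nat.succ_eq_add_one, h0] at h1
      rw [Nat.succ_eq_add_one] at h2
      omega

/-- In a schedule that is busy with levels up to `h` from a time `b` without such backlog until the
deadline of a job of `h`, this job meets its deadline. -/
lemma meetsDeadline_of_busy (hΓ : Γ.FixedPrioritySchedulable) {S : Γ.Scenario} {σ : Schedule N}
    (hσ : S.Valid σ) {h : Fin N} {r b : ℕ} (hr : r ∈ S.release h) (hbD : b ≤ r + Γ.p h)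
    (hb : ∀ i ≤ h, S.backlog σ i b = 0)
    (hbusy : ∀ t, b ≤ t → t < r + Γ.p h → ∃ i ∈ Finset.Iic h, σ t = some i) :
    S.MeetsDeadline σ h r := by
  rcases Nat.lt_or_ge r b with hrb | hbr
  · exact S.meetsDeadline_of_backlog_eq_zero σ hr hrb hbD (hb h le_rfl)
  have hτ := (S.discard b).isFixedPriority_fpSchedule
  have hmet := hΓ _ _ hτ
  set τ := (S.discard b).fpSchedule
  have h1 := S.sum_service_le hσ h (fun i hi => hb i hi.le) hτ hmet hbD
  have h2 := length_le_sum_service σ (Finset.Iic h) le_rfl hbD hbusy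
  have h3 := sum_service_le_length τ (Finset.Iic h) hbD
  have hsplit : ∀ ρ : Schedule N, ∑ i ∈ Finset.Iic h, service ρ i b (r + Γ.p h) =
      service ρ h b (r + Γ.p h) + ∑ i ∈ Finset.Iio h, service ρ i b (r + Γ.p h) := by
    intro ρ
    rw [← Finset.Iio_insert h, Finset.sum_insert (by simp)]
  rw [hsplit] at h2 h3
  have h4 := hτ.1.service_add_backlog_eq h (fun r hr => backlog_eq_zero_of_mem hmet hr) hbD
  have hr' : r ∈ (S.discard b).release h := ⟨hr, hbr⟩
  rw [((S.discard b).meetsDeadline_iff τ hr').1 (hmet h r hr'), backlog_discard,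
    demand_discard] at h4
  have h5 := hσ.service_add_backlog_le h hbD
  rw [hb h le_rfl] at h5
  rw [meetsDeadline_iff S σ hr]
  omega

/-! ### The schedulability test -/

/-- The length of a finite busy interval solves the busy-interval equation. -/
lemma busyInterval_eq {h : Fin N} {s w W : ℕ} (hW : S.busyInterval σ h s w = (W : ℕ∞)) :
    W = S.busyBase σ h s w + ∑ j ∈ S.hpe σ h s,
      ⌈((W : ℚ) - (S.offset j s : ℚ)) / (Γ.p j : ℚ)⌉₊ * Γ.e j := by
  unfold busyInterval at hW
  split_ifs at hW with H
  swap
  · exact absurd hW (ENat.natCast_ne_top W).symm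
  have h1 : S.busyIter σ h s w (Nat.find H) = W := by exact_mod_cast hW
  have h2 := Nat.find_spec H
  rw [h1, busyIter, h1] at h2
  exact h2.symm

/-- The next release is not earlier than announced by `lastRelease`. -/
lemma lastRelease_add_le {j : Fin N} {s r : ℕ} (hr : r ∈ S.release j) (hsr : s < r) :
    S.lastRelease j s + Γ.p j ≤ r := by
  unfold lastRelease
  split_ifs with h
  · have := S.sporadic j _ h.current_mem r hr (by have := S.current_le j s; omega)
    exact_mod_cast this
  · have := S.first_le j r hr
    omega

lemma demand_le_ceil (j : Fin N) (s W : ℕ) :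
    S.demand j (s + 1) (s + W) ≤
      ⌈((W : ℚ) - (S.offset j s : ℚ)) / (Γ.p j : ℚ)⌉₊ * Γ.e j := by
  refine S.demand_le_mul j _ _ (s + 1) (S.lastRelease j s + Γ.p j)
    (fun r hr hsr => S.lastRelease_add_le hr hsr) ?_
  have hp : (0 : ℚ) < Γ.p j := by exact_mod_cast Γ.p_pos j
  have h1 := (div_le_iff₀ hp).1
    (Nat.le_ceil (((W : ℚ) - (S.offset j s : ℚ)) / (Γ.p j : ℚ)))
  set n := ⌈((W : ℚ) - (S.offset j s : ℚ)) / (Γ.p j : ℚ)⌉₊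
  have h2 : (W : ℤ) - S.offset j s ≤ n * Γ.p j := by exact_mod_cast h1
  unfold offset at h2
  push_cast
  linarith

/-- If `h` passes the test at `s` with window `w`, and only levels up to `h` are executed from the
end of the window to the end of the busy interval, then these levels have no backlog at the end
of the busy interval. -/
lemma backlog_eq_zero_of_passesTest {S : Γ.Scenario} {σ : Schedule N} (hσ : S.Valid σ)
    {h : Fin N} {s w W : ℕ} (hw : 0 < w) (hW : S.busyInterval σ h s w = (W : ℕ∞))
    (hdl : (s : ℤ) + W ≤ S.effectiveDeadline σ h s)
    (hbusy : ∀ t, s + w ≤ t → t < s + W → ∃ i ∈ Finset.Iic h, σ t = some i) :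
    w ≤ W ∧ ∀ i ≤ h, S.backlog σ i (s + W) = 0 := by
  have hfix := S.busyInterval_eq σ hW
  have hwW : w ≤ W := by
    have : w ≤ S.busyBase σ h s w := by unfold busyBase; omega
    omega
  refine ⟨hwW, ?_⟩
  have hslots := length_le_sum_service σ (Finset.Iic h) (show s ≤ s + w by omega)
    (show s + w ≤ s + W by omega) hbusy
  have hacc := Finset.sum_le_sum fun i (_ : i ∈ Finset.Iic h) =>
    hσ.service_add_backlog_le_pending i (show s < s + W by omega)
  simp only [Finset.sum_add_distrib] at hacc
  have hres := Finset.sum_le_sum fun i (_ : i ∈ Finset.Iic h) => S.pending_le_residue σ i s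
  have hbase : S.busyBase σ h s w = w + ∑ i ∈ Finset.Iic h, S.residue σ i s := by
    rw [busyBase, ← Finset.Iio_insert h, Finset.sum_insert (by simp), add_assoc]
  have hdem : ∑ i ∈ Finset.Iic h, S.demand i (s + 1) (s + W) ≤ ∑ j ∈ S.hpe σ h s,
      ⌈((W : ℚ) - (S.offset j s : ℚ)) / (Γ.p j : ℚ)⌉₊ * Γ.e j := by
    unfold hpe
    split_ifs with hact
    · -- The busy interval ends by the deadline of the current job of `h`, so that `h` is not
      -- released again within it.
      have h0 : S.demand h (s + 1) (s + W) = 0 := by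
        refine S.demand_eq_zero fun r hr hsr => ?_
        have := S.lastRelease_add_le hr hsr
        rw [effectiveDeadline, if_pos hact, d] at hdl
        omega
      rw [← Finset.Iio_insert h, Finset.sum_insert (by simp), h0, zero_add]
      exact Finset.sum_le_sum fun j _ => S.demand_le_ceil j s W
    · exact Finset.sum_le_sum fun j _ => S.demand_le_ceil j s W
  have hzero : ∑ i ∈ Finset.Iic h, S.backlog σ i (s + W) = 0 := by omega
  intro i hi
  exact Finset.sum_eq_zero_iff.1 hzero i (Finset.mem_Iic.2 hi)

/-- The effective deadline never exceeds the deadline of a job that is going to miss it. -/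
lemma effectiveDeadline_le {h : Fin N} {r s : ℕ} (hr : r ∈ S.release h)
    (hmiss : ¬ S.MeetsDeadline σ h r) (hs : s < r + Γ.p h) :
    S.effectiveDeadline σ h s ≤ r + Γ.p h := by
  unfold effectiveDeadline
  split_ifs with hact
  · have hcur := hact.1.current_mem
    have hle := S.current_le h s
    have : S.current h s ≤ r := by
      by_contra hlt
      have := S.sporadic h r hr _ hcur (not_le.1 hlt)
      omega
    rw [lastRelease, if_pos hact.1, d]
    omega
  · have hsr : s < r := by
      by_contra hle
      exact hact (S.active_of_not_meetsDeadline σ hr hmiss (not_lt.1 hle) hs)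
    have := S.lastRelease_add_le hr hsr
    rw [d]
    omega

/-- Before a missed deadline of `h`, a shuffled schedule has a time without backlog of the levels
up to `h` from which on it executes only these levels. -/
lemma exists_busy_start {S : Γ.Scenario} {σ : Schedule N} (hσ : S.IsTaskShuffler σ) {h : Fin N}
    {r : ℕ} (hr : r ∈ S.release h) (hmiss : ¬ S.MeetsDeadline σ h r) :
    ∃ b ≤ r + Γ.p h, (∀ i ≤ h, S.backlog σ i b = 0) ∧
      ∀ t, b ≤ t → t < r + Γ.p h → ∃ i ∈ Finset.Iic h, σ t = some i := by
  by_cases H : ∃ u, u < r + Γ.p h ∧ ¬ ∃ i ∈ Finset.Iic h, σ u = some i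
  swap
  · push Not at H
    exact ⟨0, Nat.zero_le _, fun i _ => rfl, fun t _ ht => H t ht⟩
  obtain ⟨u, ⟨huD, hu⟩, hlast⟩ : ∃ u, (u < r + Γ.p h ∧ ¬ ∃ i ∈ Finset.Iic h, σ u = some i) ∧
      ∀ t, u < t → t < r + Γ.p h → ∃ i ∈ Finset.Iic h, σ t = some i := by
    obtain ⟨u₀, hu₀D, hu₀⟩ := H
    refine ⟨Nat.findGreatest (fun u => u < r + Γ.p h ∧ ¬ ∃ i ∈ Finset.Iic h, σ u = some i)
      (r + Γ.p h), Nat.findGreatest_spec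
        (P := fun u => u < r + Γ.p h ∧ ¬ ∃ i ∈ Finset.Iic h, σ u = some i) hu₀D.le
        ⟨hu₀D, hu₀⟩, fun t hut ht => ?_⟩
    by_contra hno
    exact Nat.findGreatest_is_greatest hut ht.le ⟨ht, hno⟩
  have hhigh : ∀ i ≤ h, i ∈ Higher (σ u) := by
    intro i hi
    cases hc : σ u with
    | none => trivial
    | some j =>
      have hj : ¬ j ≤ h := fun hj => hu ⟨j, Finset.mem_Iic.2 hj, hc⟩
      exact lt_of_le_of_lt hi (not_le.1 hj)
  rcases hσ.2 u with hno | ⟨s, w, hsu, huw, hallow, -, -⟩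
  · exact ⟨u + 1, huD, fun i hi => S.backlog_succ_eq_zero_of_not_active σ (hno i (hhigh i hi)),
      fun t hut ht => hlast t hut ht⟩
  · obtain ⟨W, hW, hdl⟩ := hallow h (hhigh h le_rfl)
    have hWD : s + W ≤ r + Γ.p h := by
      have := S.effectiveDeadline_le σ hr hmiss (hsu.trans_lt huD)
      omega
    obtain ⟨hwW, hb⟩ := backlog_eq_zero_of_passesTest hσ.1 (by omega) hW hdl
      fun t hst ht => hlast t (by omega) (by omega)
    exact ⟨s + W, hWD, hb, fun t hst ht => hlast t (by omega) ht⟩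

end Scenario

end TaskSet

theorem theorem1 {N : ℕ} (Γ : TaskSet N) (hΓ : Γ.FixedPrioritySchedulable) :
    Γ.TaskShufflerSchedulable := by
  intro S σ hσ h r hr
  by_contra hmiss
  obtain ⟨b, hbD, hb, hbusy⟩ := TaskSet.Scenario.exists_busy_start hσ hr hmiss
  exact hmiss (TaskSet.Scenario.meetsDeadline_of_busy hΓ hσ.1 hr hbD hb hbusy)
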